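/- **Theorem (Rademacher complexity bound).** There is a universal constant $C>0$ such that the following holds. Let $P$ be a probability distribution on $\mathcal X\times\mathcal Y$, let $n\ge 1$, and let $d,T\ge 0$ be integers. Let $g:\mathbb R\to\mathbb R$ be $L$-Lipschitz, let $\varphi:\mathcal X\to\mathbb R^d$ be a measurable feature map with $\|\varphi(x)\|_2\le B$ for all $x$, and let $\Theta\subseteq(\mathbb R^d)^T$ be a set of admissible task weights $\theta=(\theta_1,\dots,\theta_T)$ with $\sum_{t=1}^T\|\theta_t\|_2^2\le A^2$ for all $\theta\in\Theta$, where $A\ge 0$ (for instance a single tuple, or tuples $\theta_t=\lambda_t w_t$ with $\lambda$ in the probability simplex and $\|w_t\|_2\le A$). Let $$\mathcal H_{\mathrm{rot}}=\Big\{x\mapsto g\Big(\sum_{t=1}^T\theta_t^\top R^t\varphi(x)\Big)\;:\;\theta\in\Theta,\ R^1,\dots,R^T\in SO(d)\Big\}.$$ Let $\ell:\mathbb R\times\mathcal Y\to[0,1]$ be a measurable loss that is $1$-Lipschitz in its first argument. For $h:\mathcal X\to\mathbb R$ and a sample $S=((x_i,y_i))_{i\le n}$ put $\mathcal R(h)=\mathbb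 E_{(x,y)\sim P}\,\ell(h(x),y)$ and $\hat{\mathcal R}(h)=\frac1n\sum_{i=1}^n\ell(h(x_i),y_i)$, and let $$\mathcal R_n(\mathcal H_{\mathrm{rot}})=\mathbb E_{S}\,\mathbb E_{\sigma}\sup_{h\in\mathcal H_{\mathrm{rot}}}\frac1n\sum_{i=1}^n\sigma_i h(x_i)$$ be the Rademacher complexity, where $S\sim P^{\otimes n}$ and $\sigma$ is uniform on $\{-1,1\}^n$ (with the supremum over the empty set read as $0$). Then: 1. for every $\delta>0$, with probability at least $1-\delta$ over $S\sim P^{\otimes n}$, simultaneously for all $\hat h\in\mathcal H_{\mathrm{rot}}$ (in particular for any hypothesis chosen from the sample), $$\mathcal R(\hat h)\le\hat{\mathcal R}(\hat h)+2\,\mathcal R_n(\mathcal H_{\mathrm{rot}})+\sqrt{\frac{\log(2/\delta)}{2n}},$$ where for $\delta>2$ (when the probability claim is void) the last square root is read as $0$; 2. if $nT\ge 2$, then $$\mathcal R_n(\mathcal H_{\mathrm{rot}})\le C\,L\,A\,B\,\sqrt{\frac{d^2\,T\,\log(nT)}{n}}.$$ -/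

import Mathlib

open MeasureTheory
open scoped NNReal Matrix

noncomputable section

/-- The class of rotation-merged models
`x ↦ g (∑ t, θ_tᵀ R^t φ(x))`, with rotations `R^t ∈ SO(d)` and head tuple `θ = (θ_1, …, θ_T)`
in the admissible set `Θ`. For fixed heads, `Θ = {θ}`. -/
def rotClass {X : Type*} {d T : ℕ} (g : ℝ → ℝ) (φ : X → EuclideanSpace ℝ (Fin d))
    (Θ : Set (Fin T → EuclideanSpace ℝ (Fin d))) : Set (X → ℝ) :=
  {h | ∃ θ ∈ Θ, ∃ R : Fin T → Matrix.specialOrthogonalGroup (Fin d) ℝ,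
    h = fun x => g (∑ t, (θ t).ofLp ⬝ᵥ ((R t : Matrix (Fin d) (Fin d) ℝ) *ᵥ (φ x).ofLp))}

/-- Population risk `E_{(x,y) ∼ P} ℓ(h(x), y)`. -/
def populationRisk {X Y : Type*} [MeasurableSpace X] [MeasurableSpace Y]
    (P : Measure (X × Y)) (ℓ : ℝ → Y → ℝ) (h : X → ℝ) : ℝ :=
  ∫ z, ℓ (h z.1) z.2 ∂P

/-- Empirical risk `(1/n) ∑ i, ℓ(h(x_i), y_i)` on the sample `S = ((x_i, y_i))_i`. -/
def empiricalRisk {X Y : Type*} {n : ℕ} (ℓ : ℝ → Y → ℝ) (S : Fin n → X × Y) (h : X → ℝ) : ℝ :=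
  (∑ i, ℓ (h (S i).1) (S i).2) / n

/-- Empirical Rademacher complexity `E_σ sup_{h ∈ H} (1/n) ∑ i, σ_i h(x_i)`, where `σ` is uniform
on the `2 ^ n` sign vectors. -/
def empiricalRademacher {X : Type*} {n : ℕ} (H : Set (X → ℝ)) (x : Fin n → X) : ℝ :=
  (∑ σ : Fin n → ℤˣ, ⨆ h : H, (∑ i, ((σ i : ℤ) : ℝ) * (h : X → ℝ) (x i)) / n) / 2 ^ n

/-- Rademacher complexity `R_n(H)`: the expected empirical Rademacher complexity of `n`
independent points drawn from `D`. -/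
def rademacherComplexity {X : Type*} [MeasurableSpace X] (D : Measure X) (n : ℕ)
    (H : Set (X → ℝ)) : ℝ :=
  ∫ x, empiricalRademacher H x ∂(Measure.pi fun _ : Fin n => D)

end

/-! Rotations can be moved onto the heads: `θᵀ R φ = (Rᵀ θ)ᵀ φ`. The class is therefore `g` composed
with the linear functionals of vectors `v = ∑ (R^t)ᵀ θ_t`, and since rotations are isometries,
Cauchy–Schwarz gives `‖v‖ ≤ ∑ ‖θ_t‖ ≤ A √T`. Contraction (`sum_signs_iSup_le_of_abs_sub_le`) removes
`g` at the cost of a factor `L`, and the linear class is controlled by the second moment of a signed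
sum (`sum_signs_norm_le`). This yields `L A B √(T / n)`, with neither dimension nor logarithm. The
stated rate is weaker: for `d ≥ 1` and `nT ≥ 2` the factor `d² log (nT)` is at least `1/4`, and for
`d = 0` the features vanish.

For the risk bound, McDiarmid's inequality concentrates the largest deviation around its mean,
symmetrization (`integral_iSup_sub_mean_le`) bounds the mean by twice the complexity of the loss
class, and contraction removes the 1-Lipschitz loss. Suprema over uncountable classes are made
measurable by passing to a dense sequence of parameters, on which everything depends continuously.
-/

/-! ### Sums over signs: contraction and second moments. -/

theorem sum_signs_succ {M : Type*} [AddCommMonoid M] {n : ℕ} (F : (Fin (n + 1) → ℤˣ) → M) :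
    ∑ σ, F σ = ∑ σ : Fin n → ℤˣ, (F (Fin.cons 1 σ) + F (Fin.cons (-1) σ)) := by
  rw [← (Fin.consEquiv fun _ : Fin (n + 1) => ℤˣ).sum_comp F, Fintype.sum_prod_type_right]
  refine Finset.sum_congr rfl fun σ _ => ?_
  rw [UnitsInt.univ, Finset.sum_pair (by decide)]
  rfl

theorem abs_intUnit_cast (s : ℤˣ) : |((s : ℤ) : ℝ)| = 1 := by
  rcases Int.units_eq_one_or s with h | h <;> simp [h]

theorem abs_sum_signs_mul_le {n : ℕ} (σ : Fin n → ℤˣ) {u : Fin n → ℝ} {M : ℝ}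
    (hu : ∀ j, |u j| ≤ M) : |∑ j, ((σ j : ℤ) : ℝ) * u j| ≤ n * M := by
  calc |∑ j, ((σ j : ℤ) : ℝ) * u j| ≤ ∑ j, |((σ j : ℤ) : ℝ) * u j| :=
        Finset.abs_sum_le_sum_abs _ _
    _ ≤ ∑ _j : Fin n, M := Finset.sum_le_sum fun j _ => by
        rw [abs_mul, abs_intUnit_cast, one_mul]; exact hu j
    _ = n * M := by simp

theorem bddAbove_range_of_abs_le {ι : Type*} {f : ι → ℝ} {M : ℝ} (hf : ∀ i, |f i| ≤ M) :
    BddAbove (Set.range f) :=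
  ⟨M, by rintro _ ⟨i, rfl⟩; exact (abs_le.1 (hf i)).2⟩

/-- Contraction for a single sign. For a pair `i, i'` the left side is `a i + a i' + (v i - v i')`,
at most `a i + a i' + |u i - u i'|`. The absolute value is attained by one of the two ways of
assigning `i, i'` to the suprema on the right. -/
theorem iSup_add_add_iSup_sub_le {ι : Type*} [Nonempty ι] {a v u : ι → ℝ}
    (hvu : ∀ i i', |v i - v i'| ≤ |u i - u i'|)
    (h₁ : BddAbove (Set.range fun i => a i + u i)) (h₂ : BddAbove (Set.range fun i => a i - u i)) :
    (⨆ i, (a i + v i)) + ⨆ i, (a i - v i) ≤ (⨆ i, (a i + u i)) + ⨆ i, (a i - u i) := by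
  refine ciSup_add_ciSup_le fun i i' => ?_
  have e₁ := le_ciSup h₁ i
  have e₂ := le_ciSup h₁ i'
  have e₃ := le_ciSup h₂ i
  have e₄ := le_ciSup h₂ i'
  have hv := (le_abs_self _).trans (hvu i i')
  rcases abs_cases (u i - u i') with h | h <;> linarith

/-- The contraction principle for Rademacher sums: replacing each coordinate process by one with
larger increments does not decrease the expected supremum. -/
theorem sum_signs_iSup_le_of_abs_sub_le {ι : Type*} [Nonempty ι] {M : ℝ} {n : ℕ}
    {v u : ι → Fin n → ℝ} {a : ι → ℝ} {M' : ℝ}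
    (ha : ∀ i, |a i| ≤ M') (hv : ∀ i j, |v i j| ≤ M) (hu : ∀ i j, |u i j| ≤ M)
    (hvu : ∀ i i' j, |v i j - v i' j| ≤ |u i j - u i' j|) :
    ∑ σ : Fin n → ℤˣ, ⨆ i, (a i + ∑ j, ((σ j : ℤ) : ℝ) * v i j) ≤
      ∑ σ : Fin n → ℤˣ, ⨆ i, (a i + ∑ j, ((σ j : ℤ) : ℝ) * u i j) := by
  induction n generalizing a M' with
  | zero => simp
  | succ n ih =>
    rw [sum_signs_succ, sum_signs_succ]
    simp only [Fin.sum_univ_succ, Fin.cons_zero, Fin.cons_succ, Units.val_one, Int.cast_one,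
      one_mul, Units.val_neg, Int.cast_neg, neg_mul, ← add_assoc, ← sub_eq_add_neg]
    rw [Finset.sum_add_distrib]
    -- The offset absorbs `± v i 0`, so the induction hypothesis exchanges the later coordinates;
    -- coordinate `0` is exchanged afterwards, for each fixed choice of the other signs.
    have hp := ih (a := fun i => a i + v i 0) (v := fun i j => v i j.succ)
      (u := fun i j => u i j.succ) (M' := M' + M)
      (fun i => (abs_add_le _ _).trans (add_le_add (ha i) (hv i 0)))
      (fun i j => hv i _) (fun i j => hu i _) (fun i i' j => hvu i i' _)
    have hm := ih (a := fun i => a i - v i 0) (v := fun i j => v i j.succ)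
      (u := fun i j => u i j.succ) (M' := M' + M)
      (fun i => (abs_sub _ _).trans (add_le_add (ha i) (hv i 0)))
      (fun i j => hv i _) (fun i j => hu i _) (fun i i' j => hvu i i' _)
    refine (add_le_add hp hm).trans ?_
    rw [← Finset.sum_add_distrib]
    refine Finset.sum_le_sum fun σ _ => ?_
    have hb : ∀ i, |a i + ∑ j : Fin n, ((σ j : ℤ) : ℝ) * u i j.succ| ≤ M' + n * M := fun i =>
      (abs_add_le _ _).trans (add_le_add (ha i) (abs_sum_signs_mul_le σ fun j => hu i _))
    have key := iSup_add_add_iSup_sub_le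
      (a := fun i => a i + ∑ j : Fin n, ((σ j : ℤ) : ℝ) * u i j.succ) (v := fun i => v i 0)
      (u := fun i => u i 0) (fun i i' => hvu i i' 0)
      (bddAbove_range_of_abs_le fun i => (abs_add_le _ _).trans (add_le_add (hb i) (hu i 0)))
      (bddAbove_range_of_abs_le fun i => (abs_sub _ _).trans (add_le_add (hb i) (hu i 0)))
    simpa only [add_right_comm, add_sub_right_comm] using key

/-- Cross terms cancel when signs are averaged; in the induction this is the parallelogram law, with
the offset `a` carrying the coordinates already treated. -/
theorem sum_signs_norm_sq {E : Type*} [NormedAddCommGroup E] [InnerProductSpace ℝ E] {n : ℕ}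
    (a : E) (x : Fin n → E) :
    ∑ σ : Fin n → ℤˣ, ‖a + ∑ j, ((σ j : ℤ) : ℝ) • x j‖ ^ 2 =
      2 ^ n * (‖a‖ ^ 2 + ∑ j, ‖x j‖ ^ 2) := by
  induction n generalizing a with
  | zero => simp
  | succ n ih =>
    rw [sum_signs_succ]
    simp only [Fin.sum_univ_succ, Fin.cons_zero, Fin.cons_succ, Units.val_one, Int.cast_one,
      one_smul, Units.val_neg, Int.cast_neg, neg_smul, ← add_assoc, ← sub_eq_add_neg]
    rw [Finset.sum_add_distrib, ih, ih]
    have := parallelogram_law_with_norm ℝ a (x 0)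
    rw [pow_succ]
    linear_combination 2 ^ n * this

theorem sum_signs_norm_le {E : Type*} [NormedAddCommGroup E] [InnerProductSpace ℝ E] {n : ℕ}
    {x : Fin n → E} {B : ℝ} (hB : 0 ≤ B) (hx : ∀ j, ‖x j‖ ≤ B) :
    ∑ σ : Fin n → ℤˣ, ‖∑ j, ((σ j : ℤ) : ℝ) • x j‖ ≤ 2 ^ n * (B * √n) := by
  have h := sum_signs_norm_sq (0 : E) x
  simp only [zero_add, norm_zero, ne_eq, OfNat.ofNat_ne_zero, not_false_eq_true, zero_pow] at h
  have hcs := sq_sum_le_card_mul_sum_sq (s := (Finset.univ : Finset (Fin n → ℤˣ)))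
    (f := fun σ => ‖∑ j, ((σ j : ℤ) : ℝ) • x j‖)
  have hcard : ((Finset.univ : Finset (Fin n → ℤˣ)).card : ℝ) = 2 ^ n := by
    simp [Finset.card_univ, Fintype.card_units_int]
  rw [hcard, h] at hcs
  have hs : ∑ j, ‖x j‖ ^ 2 ≤ n * B ^ 2 := by
    calc ∑ j, ‖x j‖ ^ 2 ≤ ∑ _j : Fin n, B ^ 2 :=
          Finset.sum_le_sum fun j _ => pow_le_pow_left₀ (norm_nonneg _) (hx j) 2
      _ = n * B ^ 2 := by simp
  refine abs_le_of_sq_le_sq' ?_ (by positivity) |>.2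
  refine hcs.trans ?_
  rw [mul_pow, mul_pow, Real.sq_sqrt (Nat.cast_nonneg n), ← mul_assoc, ← sq]
  gcongr
  linarith

/-! ### Concentration under bounded differences. -/

theorem Measurable.integrable_of_abs_le {Ω : Type*} [MeasurableSpace Ω] {μ : Measure Ω}
    [IsFiniteMeasure μ] {f : Ω → ℝ} (hf : Measurable f) {M : ℝ} (hM : ∀ ω, |f ω| ≤ M) :
    Integrable f μ :=
  Integrable.of_bound hf.aestronglyMeasurable M (ae_of_all _ hM)

theorem abs_integral_le_of_abs_le {Ω : Type*} [MeasurableSpace Ω] (μ : Measure Ω)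
    [IsProbabilityMeasure μ] {f : Ω → ℝ} {M : ℝ} (hM : ∀ ω, |f ω| ≤ M) :
    |∫ ω, f ω ∂μ| ≤ M := by
  have := norm_integral_le_of_norm_le_const (μ := μ) (f := f) (ae_of_all _ hM)
  simpa using this

theorem integrable_exp_mul_of_abs_le {Ω : Type*} [MeasurableSpace Ω] {μ : Measure Ω}
    [IsFiniteMeasure μ] {f : Ω → ℝ} (hf : Measurable f) {M : ℝ} (hM : ∀ ω, |f ω| ≤ M) (t : ℝ) :
    Integrable (fun ω => Real.exp (t * f ω)) μ := by
  refine Measurable.integrable_of_abs_le (M := Real.exp (|t| * M)) (by fun_prop) fun ω => ?_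
  rw [Real.abs_exp]
  refine Real.exp_le_exp.2 ((le_abs_self _).trans ?_)
  rw [abs_mul]
  exact mul_le_mul_of_nonneg_left (hM ω) (abs_nonneg t)

/-- Hoeffding's lemma for a function of oscillation at most `c`. -/
theorem integral_exp_sub_integral_le_of_abs_sub_le {Ω : Type*} [MeasurableSpace Ω]
    (μ : Measure Ω) [IsProbabilityMeasure μ] {f : Ω → ℝ} (hf : Measurable f) {c : ℝ}
    (hc : ∀ ω ω', |f ω - f ω'| ≤ c) (t : ℝ) :
    ∫ ω, Real.exp (t * (f ω - ∫ ω', f ω' ∂μ)) ∂μ ≤ Real.exp (c ^ 2 * t ^ 2 / 8) := by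
  obtain ⟨ω₀⟩ : Nonempty Ω := μ.nonempty_of_neZero
  have hc0 : 0 ≤ c := (abs_nonneg _).trans (hc ω₀ ω₀)
  have hbdd : BddBelow (Set.range f) := by
    refine ⟨f ω₀ - c, ?_⟩
    rintro _ ⟨ω, rfl⟩
    linarith [(abs_le.1 (hc ω₀ ω)).2]
  -- Oscillation at most `c` confines `f` to an interval of length `c` starting at its infimum, the
  -- form required by Hoeffding's lemma.
  have hIcc : ∀ ω, f ω ∈ Set.Icc (⨅ ω', f ω') ((⨅ ω', f ω') + c) := fun ω => by
    have : Nonempty Ω := ⟨ω₀⟩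
    refine ⟨ciInf_le hbdd ω, ?_⟩
    rw [← sub_le_iff_le_add]
    exact le_ciInf fun ω' => by linarith [(abs_le.1 (hc ω ω')).2]
  have h := (ProbabilityTheory.hasSubgaussianMGF_of_mem_Icc (μ := μ) hf.aemeasurable
    (ae_of_all _ hIcc)).mgf_le t
  rw [ProbabilityTheory.mgf] at h
  refine h.trans (Real.exp_le_exp.2 (le_of_eq ?_))
  have : ((‖(⨅ ω', f ω') + c - ⨅ ω', f ω'‖₊ : ℝ≥0) : ℝ) = c := by
    rw [add_sub_cancel_left, coe_nnnorm, Real.norm_of_nonneg hc0]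
  push_cast [this]
  ring

/-- McDiarmid's bound on the moment generating function of a function of independent variables
with bounded differences. -/
theorem integral_exp_sub_integral_le_of_bounded_differences {Z : Type*} [MeasurableSpace Z]
    (P : Measure Z) [IsProbabilityMeasure P] {c M : ℝ} {n : ℕ} {G : (Fin n → Z) → ℝ}
    (hG : Measurable G) (hM : ∀ S, |G S| ≤ M)
    (hc : ∀ S i z, |G (Function.update S i z) - G S| ≤ c) (t : ℝ) :
    ∫ S, Real.exp (t * (G S - ∫ S', G S' ∂(Measure.pi fun _ => P))) ∂(Measure.pi fun _ => P) ≤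
      Real.exp (n * c ^ 2 * t ^ 2 / 8) := by
  induction n with
  | zero =>
    have : ∀ S, G S = G default := fun S => congrArg G (Subsingleton.elim _ _)
    simp [this]
  | succ n ih =>
    set Q : Measure (Fin n → Z) := Measure.pi fun _ => P
    have hcons : Measurable fun p : Z × (Fin n → Z) => (Fin.cons p.1 p.2 : Fin (n + 1) → Z) := by
      refine measurable_pi_iff.2 fun i => ?_
      refine Fin.cases ?_ (fun j => ?_) i
      · simpa using measurable_fst
      · simp only [Fin.cons_succ]
        exact (measurable_pi_apply j).comp measurable_snd
    have hpres : MeasurePreserving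
        (fun p : Z × (Fin n → Z) => (Fin.cons p.1 p.2 : Fin (n + 1) → Z))
        (P.prod Q) (Measure.pi fun _ => P) := by
      have := (measurePreserving_piFinSuccAbove (fun _ : Fin (n + 1) => P) 0).symm
      refine ⟨hcons, ?_⟩
      rw [← this.map_eq]
      congr 1
      funext p
      exact (Fin.insertNth_zero' p.1 p.2).symm
    have hswap : ∀ {f : (Fin (n + 1) → Z) → ℝ}, Measurable f → ∀ {K : ℝ}, (∀ S, |f S| ≤ K) →
        ∫ S, f S ∂(Measure.pi fun _ => P) = ∫ x, ∫ z, f (Fin.cons z x) ∂P ∂Q := by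
      intro f hf K hK
      rw [← hpres.map_eq, integral_map hcons.aemeasurable hf.aestronglyMeasurable]
      exact integral_prod_symm _ ((hf.comp hcons).integrable_of_abs_le fun p => hK _)
    have hGc : Measurable fun p : Z × (Fin n → Z) => G (Fin.cons p.1 p.2) := hG.comp hcons
    have hGx : ∀ x : Fin n → Z, Measurable fun z => G (Fin.cons z x) := fun x =>
      hGc.comp (measurable_id.prodMk measurable_const)
    -- `F` averages out coordinate `0`; it inherits the bounds on values and differences, so the
    -- induction hypothesis applies to it.
    set F : (Fin n → Z) → ℝ := fun x => ∫ z, G (Fin.cons z x) ∂P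
    have hF : Measurable F := (hGc.stronglyMeasurable.integral_prod_left').measurable
    have hFM : ∀ x, |F x| ≤ M := fun x => abs_integral_le_of_abs_le P fun z => hM _
    have hFc : ∀ x i z, |F (Function.update x i z) - F x| ≤ c := by
      intro x i z
      rw [← integral_sub ((hGx _).integrable_of_abs_le fun z => hM _)
        ((hGx _).integrable_of_abs_le fun z => hM _)]
      refine abs_integral_le_of_abs_le P fun w => ?_
      rw [Fin.cons_update]
      exact hc _ _ _
    have hexpM : ∀ S, |Real.exp (t * (G S - ∫ S', G S' ∂(Measure.pi fun _ => P)))| ≤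
        Real.exp (|t| * (M + M)) := by
      intro S
      rw [Real.abs_exp]
      refine Real.exp_le_exp.2 ((le_abs_self _).trans ?_)
      rw [abs_mul]
      refine mul_le_mul_of_nonneg_left ((abs_sub _ _).trans (add_le_add (hM S) ?_)) (abs_nonneg t)
      exact abs_integral_le_of_abs_le _ hM
    rw [hswap (by fun_prop) hexpM, hswap hG hM]
    set m := ∫ x, F x ∂Q
    -- Conditional Hoeffding: split `G - m = (G - F x) + (F x - m)`. With `x` fixed, the first term
    -- is centred with oscillation at most `c`, and the second is constant.
    have hinner : ∀ x, ∫ z, Real.exp (t * (G (Fin.cons z x) - m)) ∂P ≤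
        Real.exp (c ^ 2 * t ^ 2 / 8) * Real.exp (t * (F x - m)) := by
      intro x
      have e : ∀ z, Real.exp (t * (G (Fin.cons z x) - m)) =
          Real.exp (t * (G (Fin.cons z x) - F x)) * Real.exp (t * (F x - m)) := fun z => by
        rw [← Real.exp_add]; congr 1; ring
      simp_rw [e]
      rw [integral_mul_const]
      refine mul_le_mul_of_nonneg_right ?_ (Real.exp_nonneg _)
      refine integral_exp_sub_integral_le_of_abs_sub_le P (hGx x) (fun z z' => ?_) t
      have := hc (Fin.cons z' x) 0 z
      rwa [Fin.update_cons_zero] at this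
    have hFexp : Integrable (fun x => Real.exp (t * (F x - m))) Q :=
      integrable_exp_mul_of_abs_le (f := fun x => F x - m) (hF.sub_const m) (M := M + M)
        (fun x => (abs_sub _ _).trans (add_le_add (hFM x) (abs_integral_le_of_abs_le _ hFM))) t
    calc ∫ x, ∫ z, Real.exp (t * (G (Fin.cons z x) - m)) ∂P ∂Q
        ≤ ∫ x, Real.exp (c ^ 2 * t ^ 2 / 8) * Real.exp (t * (F x - m)) ∂Q := by
          refine integral_mono_of_nonneg
            (ae_of_all _ fun x => integral_nonneg fun z => Real.exp_nonneg _)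
            (hFexp.const_mul _) (ae_of_all _ hinner)
      _ = Real.exp (c ^ 2 * t ^ 2 / 8) * ∫ x, Real.exp (t * (F x - m)) ∂Q :=
          integral_const_mul _ _
      _ ≤ Real.exp (c ^ 2 * t ^ 2 / 8) * Real.exp (n * c ^ 2 * t ^ 2 / 8) :=
          mul_le_mul_of_nonneg_left (ih hF hFM hFc) (Real.exp_nonneg _)
      _ = Real.exp (((n + 1 : ℕ) : ℝ) * c ^ 2 * t ^ 2 / 8) := by
          rw [← Real.exp_add]; congr 1; push_cast; ring

/-- McDiarmid's inequality. -/
theorem measureReal_ge_le_of_bounded_differences {Z : Type*} [MeasurableSpace Z]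
    (P : Measure Z) [IsProbabilityMeasure P] {c M : ℝ} {n : ℕ} {G : (Fin n → Z) → ℝ}
    (hG : Measurable G) (hM : ∀ S, |G S| ≤ M)
    (hc : ∀ S i z, |G (Function.update S i z) - G S| ≤ c) {ε : ℝ} (hε : 0 ≤ ε) :
    (Measure.pi fun _ : Fin n => P).real
        {S | ε ≤ G S - ∫ S', G S' ∂(Measure.pi fun _ => P)} ≤
      Real.exp (-2 * ε ^ 2 / (n * c ^ 2)) := by
  have hsub : ProbabilityTheory.HasSubgaussianMGF
      (fun S => G S - ∫ S', G S' ∂(Measure.pi fun _ => P))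
      ⟨n * c ^ 2 / 4, by positivity⟩ (Measure.pi fun _ : Fin n => P) := by
    refine ⟨fun t => integrable_exp_mul_of_abs_le (hG.sub_const _) (M := M + M) (fun S =>
      (abs_sub _ _).trans (add_le_add (hM S) (abs_integral_le_of_abs_le _ hM))) t, fun t => ?_⟩
    refine (integral_exp_sub_integral_le_of_bounded_differences P hG hM hc t).trans ?_
    refine Real.exp_le_exp.2 (le_of_eq ?_)
    change _ = n * c ^ 2 / 4 * t ^ 2 / 2
    ring
  refine (hsub.measure_ge_le hε).trans (Real.exp_le_exp.2 (le_of_eq ?_))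
  change -ε ^ 2 / (2 * (n * c ^ 2 / 4)) = _
  -- In the degenerate case both quotients are divisions by zero, hence `0`.
  by_cases h : (n : ℝ) * c ^ 2 = 0
  · simp [h]
  · field_simp
    ring

/-! ### Rademacher averages and symmetrization. -/

/-- The empirical Rademacher complexity of an indexed family of functions. -/
noncomputable def rademacherAverage {ι X : Type*} {n : ℕ} (f : ι → X → ℝ) (x : Fin n → X) : ℝ :=
  (∑ σ : Fin n → ℤˣ, ⨆ k, (∑ i, ((σ i : ℤ) : ℝ) * f k (x i)) / n) / 2 ^ n

theorem abs_ciSup_le {ι : Type*} [Nonempty ι] {f : ι → ℝ} {M : ℝ} (hf : ∀ i, |f i| ≤ M) :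
    |⨆ i, f i| ≤ M := by
  obtain ⟨i⟩ := ‹Nonempty ι›
  have : Nonempty ι := ⟨i⟩
  refine abs_le.2 ⟨?_, ciSup_le fun i => (abs_le.1 (hf i)).2⟩
  exact (abs_le.1 (hf i)).1.trans (le_ciSup (bddAbove_range_of_abs_le hf) i)

theorem abs_ciSup_sub_ciSup_le {ι : Type*} [Nonempty ι] {f g : ι → ℝ} {c : ℝ}
    (hf : BddAbove (Set.range f)) (hg : BddAbove (Set.range g)) (h : ∀ i, |f i - g i| ≤ c) :
    |(⨆ i, f i) - ⨆ i, g i| ≤ c := by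
  refine abs_sub_le_iff.2 ⟨?_, ?_⟩ <;> rw [sub_le_iff_le_add] <;> refine ciSup_le fun i => ?_
  · linarith [(abs_le.1 (h i)).2, le_ciSup hg i]
  · linarith [(abs_le.1 (h i)).1, le_ciSup hf i]

theorem abs_signed_mean_le {n : ℕ} (hn : 1 ≤ n) (σ : Fin n → ℤˣ) {u : Fin n → ℝ} {M : ℝ}
    (hu : ∀ j, |u j| ≤ M) : |(∑ j, ((σ j : ℤ) : ℝ) * u j) / n| ≤ M := by
  have hn' : (0 : ℝ) < n := by exact_mod_cast hn
  rw [abs_div, Nat.abs_cast, div_le_iff₀ hn', mul_comm]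
  exact abs_sum_signs_mul_le σ hu

theorem abs_mean_le {n : ℕ} (hn : 1 ≤ n) {u : Fin n → ℝ} {M : ℝ}
    (hu : ∀ j, |u j| ≤ M) : |(∑ j, u j) / n| ≤ M := by
  simpa using abs_signed_mean_le hn 1 hu

theorem card_signs (n : ℕ) : (Fintype.card (Fin n → ℤˣ) : ℝ) = 2 ^ n := by
  simp [Fintype.card_units_int]

theorem abs_rademacherAverage_le {ι X : Type*} [Nonempty ι] {n : ℕ} (hn : 1 ≤ n)
    {f : ι → X → ℝ} {M : ℝ} (hf : ∀ k x, |f k x| ≤ M) (x : Fin n → X) :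
    |rademacherAverage f x| ≤ M := by
  rw [rademacherAverage, abs_div, abs_of_pos (a := (2 : ℝ) ^ n) (by positivity),
    div_le_iff₀ (by positivity)]
  calc _ ≤ ∑ σ : Fin n → ℤˣ, |⨆ k, (∑ i, ((σ i : ℤ) : ℝ) * f k (x i)) / n| :=
        Finset.abs_sum_le_sum_abs _ _
    _ ≤ ∑ _σ : Fin n → ℤˣ, M :=
        Finset.sum_le_sum fun σ _ => abs_ciSup_le fun k => abs_signed_mean_le hn σ fun j => hf _ _
    _ = M * 2 ^ n := by
        rw [Finset.sum_const, nsmul_eq_mul, Finset.card_univ, card_signs, mul_comm]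

theorem measurable_rademacherAverage {ι X : Type*} [Countable ι] [MeasurableSpace X] {n : ℕ}
    {f : ι → X → ℝ} (hf : ∀ k, Measurable (f k)) :
    Measurable fun x : Fin n → X => rademacherAverage f x := by
  unfold rademacherAverage
  refine Measurable.div_const (Finset.measurable_sum _ fun σ _ => Measurable.iSup fun k => ?_) _
  fun_prop

/-- Global negation permutes the sign vectors. This lets the subtracted sample in a signed
difference count as an ordinary Rademacher average. -/
theorem rademacherAverage_eq_sum_neg {ι X : Type*} {n : ℕ} (f : ι → X → ℝ) (x : Fin n → X) :
    rademacherAverage f x =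
      (∑ σ : Fin n → ℤˣ, ⨆ k, (∑ i, -((σ i : ℤ) : ℝ) * f k (x i)) / n) / 2 ^ n := by
  rw [rademacherAverage, ← Fintype.sum_equiv (Equiv.neg (Fin n → ℤˣ)) _ _ fun σ => rfl]
  simp

/-- Averaging the signed suprema over a ghost sample costs at most two Rademacher averages. -/
theorem sum_signs_iSup_sub_le {ι X : Type*} [Nonempty ι] {n : ℕ} (hn : 1 ≤ n)
    {f : ι → X → ℝ} {M : ℝ} (hf : ∀ k x, |f k x| ≤ M) (x y : Fin n → X) :
    (∑ σ : Fin n → ℤˣ, ⨆ k, (∑ i, ((σ i : ℤ) : ℝ) * (f k (y i) - f k (x i))) / n) / 2 ^ n ≤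
      rademacherAverage f x + rademacherAverage f y := by
  rw [rademacherAverage_eq_sum_neg f x, rademacherAverage, ← add_div, ← Finset.sum_add_distrib]
  refine div_le_div_of_nonneg_right (Finset.sum_le_sum fun σ _ => ciSup_le fun k => ?_)
    (by positivity)
  have hx := le_ciSup (bddAbove_range_of_abs_le (M := M)
    (f := fun k => (∑ i, -((σ i : ℤ) : ℝ) * f k (x i)) / n) fun k => by
      simpa using abs_signed_mean_le hn (-σ) fun j => hf k (x j)) k
  have hy := le_ciSup (bddAbove_range_of_abs_le (M := M)
    (f := fun k => (∑ i, ((σ i : ℤ) : ℝ) * f k (y i)) / n)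
      fun k => abs_signed_mean_le hn σ fun j => hf k (y j)) k
  refine le_trans (le_of_eq ?_) (add_le_add hx hy)
  rw [← add_div, ← Finset.sum_add_distrib]
  congr 1
  exact Finset.sum_congr rfl fun i _ => by ring

/-- Independently swapping the coordinates of i.i.d. pairs preserves their law. -/
theorem measurePreserving_swap_signs {Z : Type*} [MeasurableSpace Z] (P : Measure Z)
    [IsProbabilityMeasure P] {n : ℕ} (σ : Fin n → ℤˣ) :
    MeasurePreserving (fun (W : Fin n → Z × Z) i => if σ i = 1 then W i else (W i).swap)
      (Measure.pi fun _ => P.prod P) (Measure.pi fun _ => P.prod P) := by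
  refine measurePreserving_pi (fun _ => P.prod P) (fun _ => P.prod P)
    (f := fun i w => if σ i = 1 then w else w.swap) fun i => ?_
  by_cases h : σ i = 1
  · simp only [h, if_true]
    exact MeasurePreserving.id _
  · simpa only [h, if_false] using Measure.measurePreserving_swap

/-- Symmetrization: the expected uniform deviation is at most twice the Rademacher complexity. -/
theorem integral_iSup_sub_mean_le {ι Z : Type*} [Nonempty ι] [Countable ι] [MeasurableSpace Z]
    (P : Measure Z) [IsProbabilityMeasure P] {n : ℕ} (hn : 1 ≤ n) {f : ι → Z → ℝ}
    (hfm : ∀ k, Measurable (f k)) {M : ℝ} (hf : ∀ k z, |f k z| ≤ M) :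
    ∫ S, (⨆ k, (∫ z, f k z ∂P - (∑ i, f k (S i)) / n)) ∂(Measure.pi fun _ : Fin n => P) ≤
      2 * ∫ S, rademacherAverage f S ∂(Measure.pi fun _ : Fin n => P) := by
  set Q : Measure (Fin n → Z) := Measure.pi fun _ => P with hQ
  set D : (Fin n → Z) × (Fin n → Z) → ℝ :=
    fun p => ⨆ k, (∑ i, (f k (p.2 i) - f k (p.1 i))) / n with hD
  have hsub : ∀ k z z', |f k z - f k z'| ≤ M + M := fun k z z' =>
    (abs_sub _ _).trans (add_le_add (hf k z) (hf k z'))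
  have hDm : Measurable D := Measurable.iSup fun k => by fun_prop
  have hDb : ∀ p, |D p| ≤ M + M := fun p =>
    abs_ciSup_le fun k => abs_mean_le hn fun i => hsub k _ _
  have hmean : ∀ k, ∫ S', (∑ i, f k (S' i)) / n ∂Q = ∫ z, f k z ∂P := by
    intro k
    have hn' : (n : ℝ) ≠ 0 := by positivity
    rw [integral_div, integral_finsetSum _ fun i _ =>
      Measurable.integrable_of_abs_le (by fun_prop) fun S => hf k (S i)]
    rw [Finset.sum_congr rfl fun i _ => integral_comp_eval (μ := fun _ : Fin n => P) (i := i)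
      (hfm k).aestronglyMeasurable]
    simp [hn']
  -- The population mean is the expected mean of an independent ghost sample `S'`, and a supremum of
  -- integrals is at most the integral of the supremum.
  have hghost : ∀ S, (⨆ k, (∫ z, f k z ∂P - (∑ i, f k (S i)) / n)) ≤ ∫ S', D (S, S') ∂Q := by
    intro S
    refine ciSup_le fun k => ?_
    have hint : Integrable (fun S' : Fin n → Z => (∑ i, f k (S' i)) / n) Q :=
      Measurable.integrable_of_abs_le (by fun_prop) fun S' => abs_mean_le hn fun i => hf k (S' i)
    calc ∫ z, f k z ∂P - (∑ i, f k (S i)) / n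
        = ∫ S', ((∑ i, f k (S' i)) / n - (∑ i, f k (S i)) / n) ∂Q := by
          rw [integral_sub hint (integrable_const _), hmean]; simp
      _ ≤ ∫ S', D (S, S') ∂Q := by
          refine integral_mono (hint.sub (integrable_const _))
            ((hDm.comp measurable_prodMk_left).integrable_of_abs_le fun S' => hDb _) fun S' => ?_
          refine le_trans (le_of_eq ?_) (le_ciSup (bddAbove_range_of_abs_le
            (f := fun k => (∑ i, (f k (S' i) - f k (S i))) / n)
            fun k => abs_mean_le hn fun i => hsub k (S' i) (S i)) k)
          dsimp only
          rw [Finset.sum_sub_distrib, sub_div]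
  have hstep1 : ∫ S, (⨆ k, (∫ z, f k z ∂P - (∑ i, f k (S i)) / n)) ∂Q ≤
      ∫ p, D p ∂(Q.prod Q) := by
    rw [integral_prod _ (hDm.integrable_of_abs_le hDb)]
    refine integral_mono (Measurable.integrable_of_abs_le (M := M + M)
      (Measurable.iSup fun k => by fun_prop) fun S => abs_ciSup_le fun k => ?_)
      (hDm.integrable_of_abs_le hDb).integral_prod_left hghost
    exact (abs_sub _ _).trans (add_le_add (abs_integral_le_of_abs_le P (hf k))
      (abs_mean_le hn fun i => hf k (S i)))
  set PP : Measure (Fin n → Z × Z) := Measure.pi fun _ => P.prod P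
  have harrow : MeasurePreserving (MeasurableEquiv.arrowProdEquivProdArrow Z Z (Fin n)) PP
      (Q.prod Q) :=
    measurePreserving_arrowProdEquivProdArrow Z Z (Fin n) (fun _ => P) fun _ => P
  set E : (Fin n → ℤˣ) → (Fin n → Z × Z) → ℝ := fun σ W =>
    ⨆ k, (∑ i, ((σ i : ℤ) : ℝ) * (f k (W i).2 - f k (W i).1)) / n with hE
  have hEm : ∀ σ, Measurable (E σ) := fun σ => Measurable.iSup fun k => by fun_prop
  have hEb : ∀ σ W, |E σ W| ≤ M + M := fun σ W =>
    abs_ciSup_le fun k => abs_signed_mean_le hn σ fun i => hsub k _ _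
  have hE1 : ∫ p, D p ∂(Q.prod Q) = ∫ W, E 1 W ∂PP := by
    rw [← harrow.integral_comp' (g := D)]
    refine integral_congr_ae (ae_of_all _ fun W => ?_)
    simp only [hE, hD, Pi.one_apply, Units.val_one, Int.cast_one, one_mul]
    rfl
  -- Swapping the two points of pair `i` flips the sign of the `i`-th difference without changing
  -- the law, so all sign patterns have the same integral and may be averaged.
  have hEσ : ∀ σ, ∫ W, E σ W ∂PP = ∫ W, E 1 W ∂PP := by
    intro σ
    have hpres := measurePreserving_swap_signs P σ
    have hmap := integral_map (μ := PP) hpres.measurable.aemeasurable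
      (hEm 1).aestronglyMeasurable
    rw [hpres.map_eq] at hmap
    rw [hmap]
    refine integral_congr_ae (ae_of_all _ fun W => ?_)
    simp only [hE]
    refine iSup_congr fun k => ?_
    congr 1
    refine Finset.sum_congr rfl fun i _ => ?_
    rcases Int.units_eq_one_or (σ i) with h | h
    · simp [h]
    · have : (-1 : ℤˣ) ≠ 1 := by decide
      simp [h, this]
  have havg : ∫ W, E 1 W ∂PP = ∫ W, (∑ σ, E σ W) / 2 ^ n ∂PP := by
    rw [integral_div, integral_finsetSum _ fun σ _ => (hEm σ).integrable_of_abs_le (hEb σ),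
      Finset.sum_congr rfl fun σ _ => hEσ σ, Finset.sum_const, nsmul_eq_mul, Finset.card_univ,
      card_signs]
    field_simp
  have hRm : Measurable fun S : Fin n → Z => rademacherAverage f S :=
    measurable_rademacherAverage hfm
  have hRi : Integrable (fun S : Fin n → Z => rademacherAverage f S) Q :=
    hRm.integrable_of_abs_le fun S => abs_rademacherAverage_le hn hf S
  have hlast : ∫ W, (∑ σ, E σ W) / 2 ^ n ∂PP ≤
      ∫ p, (rademacherAverage f p.1 + rademacherAverage f p.2) ∂(Q.prod Q) := by
    rw [← harrow.integral_comp' (g := fun p : (Fin n → Z) × (Fin n → Z) =>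
      rademacherAverage f p.1 + rademacherAverage f p.2)]
    refine integral_mono ((integrable_finsetSum _ fun σ _ =>
      (hEm σ).integrable_of_abs_le (hEb σ)).div_const _) ?_ fun W => ?_
    · exact (harrow.integrable_comp_emb (MeasurableEquiv.measurableEmbedding _)).2
        (hRi.comp_fst Q |>.add (hRi.comp_snd Q))
    · exact sum_signs_iSup_sub_le hn hf (fun i => (W i).1) fun i => (W i).2
  refine hstep1.trans (hE1.trans havg |>.le.trans (hlast.trans (le_of_eq ?_)))
  rw [integral_add (hRi.comp_fst Q) (hRi.comp_snd Q), integral_fun_fst, integral_fun_snd]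
  simp [two_mul]

theorem sum_update_sub_sum {n : ℕ} {Z : Type*} (f : Z → ℝ) (S : Fin n → Z) (i : Fin n) (z : Z) :
    ∑ j, f (Function.update S i z j) - ∑ j, f (S j) = f z - f (S i) := by
  rw [← Finset.sum_sub_distrib, Finset.sum_eq_single i]
  · simp
  · intro j _ hj; simp [hj]
  · simp

/-! ### Uniform deviations for countable classes. -/

/-- Uniform deviation bound for a countable family of `[0, 1]`-valued functions. -/
theorem one_sub_le_measureReal_forall_integral_le {ι Z : Type*} [Nonempty ι] [Countable ι]
    [MeasurableSpace Z] (P : Measure Z) [IsProbabilityMeasure P] {n : ℕ} (hn : 1 ≤ n)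
    {f : ι → Z → ℝ} (hfm : ∀ k, Measurable (f k)) (hf : ∀ k z, f k z ∈ Set.Icc (0 : ℝ) 1)
    {δ : ℝ} (hδ : 0 < δ) :
    1 - δ ≤ (Measure.pi fun _ : Fin n => P).real {S | ∀ k, ∫ z, f k z ∂P ≤ (∑ i, f k (S i)) / n +
      2 * ∫ S, rademacherAverage f S ∂(Measure.pi fun _ : Fin n => P) +
        √(Real.log (2 / δ) / (2 * n))} := by
  set Q : Measure (Fin n → Z) := Measure.pi fun _ => P
  rcases le_or_gt 1 δ with h1 | h1
  · exact (by linarith : 1 - δ ≤ 0).trans measureReal_nonneg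
  have hn' : (0 : ℝ) < n := by exact_mod_cast hn
  have hf1 : ∀ k z, |f k z| ≤ 1 := fun k z => abs_le.2 ⟨by linarith [(hf k z).1], (hf k z).2⟩
  set G : (Fin n → Z) → ℝ := fun S => ⨆ k, (∫ z, f k z ∂P - (∑ i, f k (S i)) / n)
  have hb : ∀ (S : Fin n → Z) (k : ι), |∫ z, f k z ∂P - (∑ i, f k (S i)) / n| ≤ 1 + 1 := fun S k =>
    (abs_sub _ _).trans (add_le_add (abs_integral_le_of_abs_le P (hf1 k))
      (abs_mean_le hn fun i => hf1 k (S i)))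
  have hG : Measurable G := Measurable.iSup fun k => by fun_prop
  have hGb : ∀ S, |G S| ≤ 1 + 1 := fun S => abs_ciSup_le (hb S)
  have hGc : ∀ S i z, |G (Function.update S i z) - G S| ≤ 1 / n := by
    intro S i z
    refine abs_ciSup_sub_ciSup_le (bddAbove_range_of_abs_le (hb _))
      (bddAbove_range_of_abs_le (hb _)) fun k => ?_
    rw [sub_sub_sub_cancel_left, ← sub_div, abs_div, Nat.abs_cast, abs_sub_comm,
      sum_update_sub_sum]
    refine div_le_div_of_nonneg_right (abs_le.2 ⟨?_, ?_⟩) hn'.le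
    · linarith [(hf k z).1, (hf k (S i)).2]
    · linarith [(hf k z).2, (hf k (S i)).1]
  set ε := √(Real.log (2 / δ) / (2 * n))
  have hlog : 0 ≤ Real.log (2 / δ) := Real.log_nonneg (by rw [le_div_iff₀ hδ]; linarith)
  have hmc := measureReal_ge_le_of_bounded_differences P hG hGb hGc (Real.sqrt_nonneg _ : 0 ≤ ε)
  -- One point changes the deviation by at most `1 / n`. Only the upper tail is needed, so the
  -- failure probability is `δ / 2`, within the allowed `δ`.
  have hexp : Real.exp (-2 * ε ^ 2 / (n * (1 / n) ^ 2)) = δ / 2 := by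
    rw [Real.sq_sqrt (by positivity)]
    have : -2 * (Real.log (2 / δ) / (2 * n)) / (n * (1 / n) ^ 2) = -Real.log (2 / δ) := by
      field_simp
    rw [this, ← Real.log_inv, Real.exp_log (by positivity), inv_div]
  rw [hexp] at hmc
  have hmeas : MeasurableSet {S | ε ≤ G S - ∫ S', G S' ∂Q} :=
    measurableSet_le measurable_const (hG.sub_const _)
  have hcompl := probReal_compl_eq_one_sub (μ := Q) hmeas
  have hsubset : {S | ε ≤ G S - ∫ S', G S' ∂Q}ᶜ ⊆ {S | ∀ k, ∫ z, f k z ∂P ≤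
      (∑ i, f k (S i)) / n + 2 * ∫ S, rademacherAverage f S ∂Q + ε} := by
    intro S hS k
    have hS' : G S - ∫ S', G S' ∂Q < ε := not_le.1 hS
    have hk := le_ciSup (bddAbove_range_of_abs_le (hb S)) k
    have hsym := integral_iSup_sub_mean_le P hn hfm hf1
    change _ ≤ G S at hk
    change ∫ S', G S' ∂Q ≤ _ at hsym
    linarith
  have := measureReal_mono (μ := Q) hsubset
  linarith

/-! ### Contraction, dense parameters and linear classes. -/

theorem empiricalRademacher_range {ι X : Type*} {n : ℕ} (f : ι → X → ℝ) (x : Fin n → X) :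
    empiricalRademacher (Set.range f) x = rademacherAverage f x := by
  unfold empiricalRademacher rademacherAverage
  congr 1
  refine Finset.sum_congr rfl fun σ _ => ?_
  exact iSup_range' (fun h : X → ℝ => (∑ i, ((σ i : ℤ) : ℝ) * h (x i)) / n) f

/-- Contraction principle for Rademacher averages. -/
theorem rademacherAverage_le_of_abs_sub_le {ι X Y : Type*} [Nonempty ι] {n : ℕ}
    {f : ι → X → ℝ} {h : ι → Y → ℝ} {x : Fin n → X} {y : Fin n → Y} {M : ℝ}
    (hf : ∀ k i, |f k (x i)| ≤ M) (hh : ∀ k i, |h k (y i)| ≤ M)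
    (hfh : ∀ k k' i, |f k (x i) - f k' (x i)| ≤ |h k (y i) - h k' (y i)|) :
    rademacherAverage f x ≤ rademacherAverage h y := by
  have key := sum_signs_iSup_le_of_abs_sub_le (n := n) (a := fun _ : ι => 0) (M := M / n) (M' := 0)
    (v := fun k i => f k (x i) / n) (u := fun k i => h k (y i) / n) (by simp)
    (fun k i => by
      rw [abs_div, Nat.abs_cast]; exact div_le_div_of_nonneg_right (hf k i) (Nat.cast_nonneg n))
    (fun k i => by
      rw [abs_div, Nat.abs_cast]; exact div_le_div_of_nonneg_right (hh k i) (Nat.cast_nonneg n))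
    (fun k k' i => by
      rw [← sub_div, ← sub_div, abs_div, abs_div]
      exact div_le_div_of_nonneg_right (hfh k k' i) (abs_nonneg _))
  simp only [zero_add, ← mul_div_assoc, ← Finset.sum_div] at key
  exact div_le_div_of_nonneg_right key (by positivity)

/-- A continuous function has the same supremum over a dense set; the resulting countable supremum
is measurable in the sample. -/
theorem rademacherAverage_denseSeq {K X : Type*} [TopologicalSpace K]
    [TopologicalSpace.SeparableSpace K] [Nonempty K] {n : ℕ} {f : K → X → ℝ}
    (hf : ∀ x, Continuous fun k => f k x) (x : Fin n → X) :
    rademacherAverage (fun m => f (TopologicalSpace.denseSeq K m)) x = rademacherAverage f x := by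
  unfold rademacherAverage
  congr 1
  refine Finset.sum_congr rfl fun σ _ => ?_
  rw [← Dense.ciSup' (TopologicalSpace.denseRange_denseSeq K)
    (f := fun k => (∑ i, ((σ i : ℤ) : ℝ) * f k (x i)) / n)
    ((continuous_finsetSum _ fun i _ => continuous_const.mul (hf (x i))).div_const _)]
  exact (iSup_range' (fun k => (∑ i, ((σ i : ℤ) : ℝ) * f k (x i)) / n) _).symm

/-- Rademacher average of a bounded linear class composed with a Lipschitz link. -/
theorem rademacherAverage_comp_inner_le {ι X E : Type*} [Nonempty ι] [NormedAddCommGroup E]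
    [InnerProductSpace ℝ E] {n : ℕ} {w : ι → E} {r : ℝ} (hw : ∀ k, ‖w k‖ ≤ r) {φ : X → E} {B : ℝ}
    (hB : ∀ x, ‖φ x‖ ≤ B) (hB0 : 0 ≤ B) {L : ℝ≥0} {g : ℝ → ℝ} (hg : LipschitzWith L g)
    (x : Fin n → X) :
    rademacherAverage (fun k x => g (inner ℝ (w k) (φ x))) x ≤ L * r * B * √n / n := by
  have hr : 0 ≤ r := (norm_nonneg _).trans (hw (Classical.arbitrary ι))
  have hin : ∀ k x, |inner ℝ (w k) (φ x)| ≤ r * B := fun k x =>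
    (abs_real_inner_le_norm _ _).trans (mul_le_mul (hw k) (hB x) (norm_nonneg _) hr)
  have hlip : ∀ a b, |g a - g b| ≤ L * |a - b| := fun a b => by
    simpa [Real.dist_eq] using hg.dist_le_mul a b
  -- `M` only ensures that the suprema are finite; it does not enter the bound.
  refine (rademacherAverage_le_of_abs_sub_le (M := |g 0| + L * (r * B))
    (h := fun k x => L * inner ℝ (w k) (φ x)) (y := x) ?_ ?_ ?_).trans ?_
  · intro k i
    have h0 := hlip (inner ℝ (w k) (φ (x i))) 0
    rw [sub_zero] at h0
    have h1 := mul_le_mul_of_nonneg_left (hin k (x i)) L.coe_nonneg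
    have h2 := abs_sub_abs_le_abs_sub (g (inner ℝ (w k) (φ (x i)))) (g 0)
    linarith
  · intro k i
    rw [abs_mul, NNReal.abs_eq]
    have h1 := mul_le_mul_of_nonneg_left (hin k (x i)) L.coe_nonneg
    linarith [abs_nonneg (g 0)]
  · intro k k' i
    rw [← mul_sub, abs_mul, NNReal.abs_eq]
    exact hlip _ _
  · rw [rademacherAverage, div_le_iff₀ (by positivity)]
    -- By linearity the signed sum is one inner product with `∑ σ_i φ(x_i)`, and Cauchy–Schwarz
    -- makes the bound uniform in `k`.
    calc _ ≤ ∑ σ : Fin n → ℤˣ, L * r / n * ‖∑ i, ((σ i : ℤ) : ℝ) • φ (x i)‖ := by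
          refine Finset.sum_le_sum fun σ _ => ciSup_le fun k => ?_
          have e : ∑ i, ((σ i : ℤ) : ℝ) * (L * inner ℝ (w k) (φ (x i))) =
              L * inner ℝ (w k) (∑ i, ((σ i : ℤ) : ℝ) • φ (x i)) := by
            rw [inner_sum, Finset.mul_sum]
            exact Finset.sum_congr rfl fun i _ => by rw [real_inner_smul_right]; ring
          rw [e, div_mul_eq_mul_div, mul_assoc (L : ℝ)]
          refine div_le_div_of_nonneg_right (mul_le_mul_of_nonneg_left
            ((real_inner_le_norm _ _).trans ?_) L.coe_nonneg) (Nat.cast_nonneg n)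
          exact mul_le_mul_of_nonneg_right (hw k) (norm_nonneg _)
      _ ≤ L * r / n * (2 ^ n * (B * √n)) := by
          rw [← Finset.mul_sum]
          exact mul_le_mul_of_nonneg_left (sum_signs_norm_le hB0 fun j => hB (x j)) (by positivity)
      _ = L * r * B * √n / n * 2 ^ n := by ring

/-- Uniform deviation bound for a separable, pointwise continuously parametrized class. -/
theorem one_sub_le_measureReal_forall_populationRisk_le {K X Y : Type*} [TopologicalSpace K]
    [TopologicalSpace.SeparableSpace K] [FirstCountableTopology K] [Nonempty K]
    [MeasurableSpace X] [MeasurableSpace Y] (P : Measure (X × Y)) [IsProbabilityMeasure P]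
    {n : ℕ} (hn : 1 ≤ n) {F : K → X → ℝ} (hFm : ∀ k, Measurable (F k))
    (hFc : ∀ x, Continuous fun k => F k x) {M : ℝ} (hF : ∀ k x, |F k x| ≤ M)
    {ℓ : ℝ → Y → ℝ} (hℓ : Measurable (Function.uncurry ℓ))
    (hℓ01 : ∀ z y, ℓ z y ∈ Set.Icc (0 : ℝ) 1) (hℓLip : ∀ y, LipschitzWith 1 fun z => ℓ z y)
    {δ : ℝ} (hδ : 0 < δ) :
    1 - δ ≤ (Measure.pi fun _ : Fin n => P).real {S | ∀ k,
      populationRisk P ℓ (F k) ≤ empiricalRisk ℓ S (F k) +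
        2 * rademacherComplexity P.fst n (Set.range F) + √(Real.log (2 / δ) / (2 * n))} := by
  set q : ℕ → K := TopologicalSpace.denseSeq K
  set f : K → X × Y → ℝ := fun k z => ℓ (F k z.1) z.2
  have hfm : ∀ k, Measurable (f k) := fun k =>
    hℓ.comp (((hFm k).comp measurable_fst).prodMk measurable_snd)
  have hfc : ∀ z, Continuous fun k => f k z := fun z => (hℓLip z.2).continuous.comp (hFc z.1)
  have hf1 : ∀ k z, |f k z| ≤ 1 := fun k z =>
    abs_le.2 ⟨by linarith [(hℓ01 (F k z.1) z.2).1], (hℓ01 (F k z.1) z.2).2⟩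
  have hRm : Measurable fun x : Fin n → X => rademacherAverage (fun m => F (q m)) x :=
    measurable_rademacherAverage fun m => hFm _
  have hfst : MeasurePreserving (fun (S : Fin n → X × Y) i => (S i).1)
      (Measure.pi fun _ => P) (Measure.pi fun _ => P.fst) :=
    measurePreserving_pi (fun _ => P) (fun _ => P.fst) (f := fun _ => Prod.fst)
      fun _ => ⟨measurable_fst, rfl⟩
  have hcomp : ∫ S, rademacherAverage (fun m => f (q m)) S ∂(Measure.pi fun _ : Fin n => P) ≤
      rademacherComplexity P.fst n (Set.range F) := by
    have e : rademacherComplexity P.fst n (Set.range F) =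
        ∫ S : Fin n → X × Y, rademacherAverage (fun m => F (q m)) (fun i => (S i).1)
          ∂(Measure.pi fun _ : Fin n => P) := by
      unfold rademacherComplexity
      simp_rw [empiricalRademacher_range, ← rademacherAverage_denseSeq hFc]
      rw [← hfst.map_eq, integral_map hfst.measurable.aemeasurable hRm.aestronglyMeasurable]
    rw [e]
    refine integral_mono
      ((measurable_rademacherAverage fun m => hfm _).integrable_of_abs_le fun S =>
        abs_rademacherAverage_le hn (fun m => hf1 (q m)) S)
      ((hRm.comp hfst.measurable).integrable_of_abs_le fun S =>
        abs_rademacherAverage_le hn (fun m => hF (q m)) _) fun S => ?_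
    refine rademacherAverage_le_of_abs_sub_le (M := max 1 M)
      (fun m i => (hf1 _ _).trans (le_max_left _ _))
      (fun m i => (hF _ _).trans (le_max_right _ _)) fun m m' i => ?_
    simpa [Real.dist_eq] using
      (hℓLip (S i).2).dist_le_mul (F (q m) (S i).1) (F (q m') (S i).1)
  refine (one_sub_le_measureReal_forall_integral_le P hn (f := fun m => f (q m))
    (fun m => hfm _) (fun m z => hℓ01 _ _) hδ).trans (measureReal_mono fun S hS k => ?_)
  have hpop : Continuous fun k => populationRisk P ℓ (F k) :=
    continuous_of_dominated (bound := fun _ => 1) (fun k => (hfm k).aestronglyMeasurable)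
      (fun k => ae_of_all _ fun z => hf1 k z) (integrable_const _) (ae_of_all _ hfc)
  have hemp : Continuous fun k => empiricalRisk ℓ S (F k) :=
    (continuous_finsetSum _ fun i _ => hfc (S i)).div_const _
  -- For a fixed sample both risks are continuous in `k`, so the inequality is a closed condition
  -- and extends from the dense sequence to all of `K`.
  refine (TopologicalSpace.denseRange_denseSeq K).induction_on
    (p := fun k => populationRisk P ℓ (F k) ≤ empiricalRisk ℓ S (F k) +
      2 * rademacherComplexity P.fst n (Set.range F) + √(Real.log (2 / δ) / (2 * n))) k
    (isClosed_le hpop ((hemp.add continuous_const).add continuous_const)) fun m => ?_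
  have hm := hS m
  change ∫ z, f (q m) z ∂P ≤ (∑ i, f (q m) (S i)) / n + _ + _ at hm
  change ∫ z, f (q m) z ∂P ≤ (∑ i, f (q m) (S i)) / n + _ + _
  linarith

/-! ### The rotation-merged class. -/

/-- The merged linear heads `∑ t, (R^t)ᵀ θ_t`. -/
def mergedHeads {d T : ℕ} (Θ : Set (Fin T → EuclideanSpace ℝ (Fin d))) :
    Set (EuclideanSpace ℝ (Fin d)) :=
  {v | ∃ θ ∈ Θ, ∃ R : Fin T → Matrix.specialOrthogonalGroup (Fin d) ℝ,
    v = ∑ t, WithLp.toLp 2 ((R t : Matrix (Fin d) (Fin d) ℝ)ᵀ *ᵥ (θ t).ofLp)}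

theorem norm_toLp_transpose_mulVec {d : ℕ} (R : Matrix.specialOrthogonalGroup (Fin d) ℝ)
    (v : EuclideanSpace ℝ (Fin d)) :
    ‖WithLp.toLp 2 ((R : Matrix (Fin d) (Fin d) ℝ)ᵀ *ᵥ v.ofLp)‖ = ‖v‖ := by
  have hR : (R : Matrix (Fin d) (Fin d) ℝ) * (R : Matrix (Fin d) (Fin d) ℝ)ᵀ = 1 :=
    Matrix.mem_orthogonalGroup_iff (Fin d) ℝ |>.1 (Matrix.mem_specialOrthogonalGroup_iff.1 R.2).1
  have h : ∀ w : EuclideanSpace ℝ (Fin d), ‖w‖ ^ 2 = w.ofLp ⬝ᵥ w.ofLp := fun w => by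
    rw [EuclideanSpace.real_norm_sq_eq]
    simp [dotProduct, sq]
  refine (sq_eq_sq₀ (norm_nonneg _) (norm_nonneg _)).1 ?_
  rw [h, h, Matrix.dotProduct_mulVec, Matrix.vecMul_transpose, Matrix.mulVec_mulVec, hR,
    Matrix.one_mulVec]

/-- Triangle inequality, isometry of each rotation, then Cauchy–Schwarz over the `T` tasks, which is
the source of `√T`. -/
theorem norm_le_of_mem_mergedHeads {d T : ℕ} {Θ : Set (Fin T → EuclideanSpace ℝ (Fin d))} {A : ℝ}
    (hA : 0 ≤ A) (hΘ : ∀ θ ∈ Θ, ∑ t, ‖θ t‖ ^ 2 ≤ A ^ 2) {v : EuclideanSpace ℝ (Fin d)}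
    (hv : v ∈ mergedHeads Θ) : ‖v‖ ≤ A * √T := by
  obtain ⟨θ, hθ, R, rfl⟩ := hv
  refine (norm_sum_le _ _).trans ?_
  simp_rw [norm_toLp_transpose_mulVec]
  refine abs_le_of_sq_le_sq' ?_ (by positivity) |>.2
  rw [mul_pow, Real.sq_sqrt (Nat.cast_nonneg T), mul_comm]
  refine sq_sum_le_card_mul_sum_sq.trans ?_
  rw [Finset.card_univ, Fintype.card_fin]
  exact mul_le_mul_of_nonneg_left (hΘ θ hθ) (Nat.cast_nonneg T)

theorem rotClass_eq_range {X : Type*} {d T : ℕ} (g : ℝ → ℝ) (φ : X → EuclideanSpace ℝ (Fin d))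
    (Θ : Set (Fin T → EuclideanSpace ℝ (Fin d))) :
    rotClass g φ Θ =
      Set.range fun (v : mergedHeads Θ) x => g (inner ℝ (v : EuclideanSpace ℝ (Fin d)) (φ x)) := by
  have key : ∀ (θ : Fin T → EuclideanSpace ℝ (Fin d))
      (R : Fin T → Matrix.specialOrthogonalGroup (Fin d) ℝ) (y : EuclideanSpace ℝ (Fin d)),
      inner ℝ (∑ t, WithLp.toLp 2 ((R t : Matrix (Fin d) (Fin d) ℝ)ᵀ *ᵥ (θ t).ofLp)) y =
        ∑ t, (θ t).ofLp ⬝ᵥ ((R t : Matrix (Fin d) (Fin d) ℝ) *ᵥ y.ofLp) := by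
    intro θ R y
    rw [sum_inner]
    refine Finset.sum_congr rfl fun t _ => ?_
    rw [Matrix.dotProduct_mulVec, ← Matrix.mulVec_transpose, EuclideanSpace.inner_eq_star_dotProduct,
      dotProduct_comm]
    rfl
  ext h
  constructor
  · rintro ⟨θ, hθ, R, rfl⟩
    exact ⟨⟨_, θ, hθ, R, rfl⟩, funext fun x => congrArg g (key θ R (φ x))⟩
  · rintro ⟨⟨_, θ, hθ, R, rfl⟩, rfl⟩
    exact ⟨θ, hθ, R, funext fun x => congrArg g (key θ R (φ x))⟩

/-- A non-integrable function has integral `0 ≤ c`, so a pointwise bound on the empirical complexity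
suffices without any measurability. -/
theorem integral_le_of_le_const {Ω : Type*} [MeasurableSpace Ω] (μ : Measure Ω)
    [IsProbabilityMeasure μ] {f : Ω → ℝ} {c : ℝ} (hc : 0 ≤ c) (h : ∀ ω, f ω ≤ c) :
    ∫ ω, f ω ∂μ ≤ c := by
  by_cases hf : Integrable f μ
  · simpa using integral_mono hf (integrable_const c) h
  · rwa [integral_undef hf]

/-- Dimension-free bound on the Rademacher complexity of the rotation-merged class. -/
theorem rademacherComplexity_rotClass_le {X : Type*} [MeasurableSpace X] (D : Measure X)
    [IsProbabilityMeasure D] {d T n : ℕ} {L : ℝ≥0} {A B : ℝ} (hA : 0 ≤ A) (hB0 : 0 ≤ B)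
    {g : ℝ → ℝ} (hg : LipschitzWith L g) {φ : X → EuclideanSpace ℝ (Fin d)}
    (hB : ∀ x, ‖φ x‖ ≤ B) {Θ : Set (Fin T → EuclideanSpace ℝ (Fin d))}
    (hΘ : ∀ θ ∈ Θ, ∑ t, ‖θ t‖ ^ 2 ≤ A ^ 2) :
    rademacherComplexity D n (rotClass g φ Θ) ≤ L * A * B * √(T / n) := by
  refine integral_le_of_le_const _ (by positivity) fun x => ?_
  rw [rotClass_eq_range, empiricalRademacher_range]
  rcases isEmpty_or_nonempty (mergedHeads Θ) with h | h
  · simp only [rademacherAverage, Real.iSup_of_isEmpty, Finset.sum_const_zero, zero_div]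
    positivity
  · have key := rademacherAverage_comp_inner_le (ι := mergedHeads Θ)
      (E := EuclideanSpace ℝ (Fin d)) (w := Subtype.val) (r := A * √T)
      (fun v => norm_le_of_mem_mergedHeads hA hΘ v.2) hB hB0 hg x
    refine key.trans (le_of_eq ?_)
    rw [Real.sqrt_div (Nat.cast_nonneg T), mul_div_assoc, Real.sqrt_div_self']
    ring

/-! ### The risk bound and the complexity rate. -/

theorem mainTheorem3 :
    ∃ C : ℝ, 0 < C ∧
      ∀ (X Y : Type*) [MeasurableSpace X] [MeasurableSpace Y]
        (P : Measure (X × Y)) [IsProbabilityMeasure P] (d T n : ℕ) (_hn : 1 ≤ n)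
        (L : ℝ≥0) (A B : ℝ) (_hA : 0 ≤ A)
        (g : ℝ → ℝ) (_hg : LipschitzWith L g)
        (φ : X → EuclideanSpace ℝ (Fin d)) (_hφ : Measurable φ) (_hφB : ∀ x, ‖φ x‖ ≤ B)
        (Θ : Set (Fin T → EuclideanSpace ℝ (Fin d)))
        (_hΘ : ∀ θ ∈ Θ, ∑ t, ‖θ t‖ ^ 2 ≤ A ^ 2)
        (ℓ : ℝ → Y → ℝ) (_hℓ : Measurable (Function.uncurry ℓ))
        (_hℓ01 : ∀ z y, ℓ z y ∈ Set.Icc (0 : ℝ) 1)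
        (_hℓLip : ∀ y, LipschitzWith 1 (fun z => ℓ z y)),
        (∀ δ : ℝ, 0 < δ →
          1 - δ ≤ (Measure.pi fun _ : Fin n => P).real
            {S | ∀ h ∈ rotClass g φ Θ,
              populationRisk P ℓ h ≤ empiricalRisk ℓ S h
                + 2 * rademacherComplexity P.fst n (rotClass g φ Θ)
                + Real.sqrt (Real.log (2 / δ) / (2 * n))}) ∧
        (2 ≤ n * T →
          rademacherComplexity P.fst n (rotClass g φ Θ) ≤
            C * (L * A * B) * Real.sqrt ((d : ℝ) ^ 2 * T * Real.log (n * T) / n)) := by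
  -- The constant `2` is `√4`, compensating for `d² log (nT) ≥ 1/4`.
  refine ⟨2, two_pos, ?_⟩
  intro X Y _ _ P _ d T n hn L A B hA g hg φ hφ hφB Θ hΘ ℓ hℓ hℓ01 hℓLip
  obtain ⟨x₀, -⟩ : Nonempty (X × Y) := P.nonempty_of_neZero
  have hB0 : 0 ≤ B := (norm_nonneg _).trans (hφB x₀)
  refine ⟨fun δ hδ => ?_, fun hnT => ?_⟩
  · rw [rotClass_eq_range]
    rcases isEmpty_or_nonempty (mergedHeads Θ) with h | h
    -- For an empty class the event is the whole sample space.
    · simp [hδ.le]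
    · simp only [Set.forall_mem_range]
      refine one_sub_le_measureReal_forall_populationRisk_le P hn
        (fun v => hg.continuous.measurable.comp (hφ.const_inner))
        (fun x => hg.continuous.comp (by fun_prop))
        (M := |g 0| + L * (A * √T * B)) (fun v x => ?_) hℓ hℓ01 hℓLip hδ
      have h0 := hg.dist_le_mul (inner ℝ (v : EuclideanSpace ℝ (Fin d)) (φ x)) 0
      rw [Real.dist_eq, Real.dist_eq, sub_zero] at h0
      have h1 : |inner ℝ (v : EuclideanSpace ℝ (Fin d)) (φ x)| ≤ A * √T * B :=
        (abs_real_inner_le_norm _ _).trans (mul_le_mul (norm_le_of_mem_mergedHeads hA hΘ v.2)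
          (hφB x) (norm_nonneg _) (by positivity))
      have h2 := mul_le_mul_of_nonneg_left h1 L.coe_nonneg
      have h3 := abs_sub_abs_le_abs_sub (g (inner ℝ (v : EuclideanSpace ℝ (Fin d)) (φ x))) (g 0)
      rw [Function.comp_apply]
      linarith
  · rcases Nat.eq_zero_or_pos d with rfl | hd
    -- For `d = 0` the right side is `0`; every feature vector is zero, so the bound can be used
    -- with `B = 0`.
    · refine (rademacherComplexity_rotClass_le P.fst hA le_rfl hg (B := 0)
        (fun x => by simp [Subsingleton.elim (φ x) 0]) hΘ).trans ?_
      simp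
    · refine (rademacherComplexity_rotClass_le P.fst hA hB0 hg hφB hΘ).trans ?_
      have hn' : (0 : ℝ) < n := by exact_mod_cast hn
      have hd' : (1 : ℝ) ≤ (d : ℝ) ^ 2 := one_le_pow₀ (by exact_mod_cast hd)
      have hlog : (1 : ℝ) / 4 ≤ Real.log (n * T) := by
        have : Real.log 2 ≤ Real.log (n * T) := Real.log_le_log two_pos (by exact_mod_cast hnT)
        linarith [Real.log_two_gt_d9]
      have hsqrt : √((T : ℝ) / n) ≤ 2 * √((d : ℝ) ^ 2 * T * Real.log (n * T) / n) := by
        rw [← Real.sqrt_sq (by norm_num : (0 : ℝ) ≤ 2), ← Real.sqrt_mul (by positivity)]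
        refine Real.sqrt_le_sqrt ?_
        rw [← mul_div_assoc]
        refine div_le_div_of_nonneg_right ?_ hn'.le
        have h4 : (1 : ℝ) / 4 ≤ (d : ℝ) ^ 2 * Real.log (n * T) := by nlinarith
        have hT : (0 : ℝ) ≤ T := Nat.cast_nonneg T
        nlinarith
      calc L * A * B * √((T : ℝ) / n)
          ≤ L * A * B * (2 * √((d : ℝ) ^ 2 * T * Real.log (n * T) / n)) :=
            mul_le_mul_of_nonneg_left hsqrt (by positivity)
        _ = 2 * (L * A * B) * √((d : ℝ) ^ 2 * T * Real.log (n * T) / n) := by ring
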